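/- Let $G$ be a finite graph with at least one vertex, and let $w\ge 0$ be an integer. In the token game of width $w$ on $G$, two players, Spoiler and Algorithm, alternate turns, both knowing $G$ and $w$. Spoiler places a new token on a vertex of $G$ (vertices may be used repeatedly), and Algorithm then irrevocably assigns a color to that token. In the token graph, two distinct tokens are adjacent if and only if they lie on the same vertex or on adjacent vertices of $G$. Spoiler must keep the chromatic number of the token graph at most $w$, and Algorithm must keep its coloring of the token graph proper. Let $f(w,G)$ be the minimum, over all strategies of Algorithm, of the number of colors used in the worst case. The graph $G$ is *online-perfect* if $f(w,G)=w$ for every $w$. Two distinct vertices $u,u'$ of a graph are *twins* if they have the same neighbors outside $\{u,u'\}$. *Cloning* a vertex $u$ means adding a new vertex $u'$ that is a twin of $u$, where $u$ and $u'$ may or may not be adjacent. Let $C_n$ be the cycle on $n$ vertices, $C_5^+$ the graph obtained from $C_5$ by adding one edge, and $P_5^2$ the square of the path $P_5$ on five vertices (equivalently, $C_5$ with two non-crossing chords). The *bull* is the graph consisting of a triangle together with two pendant edges attached at two different vertices of the triangle. **Theorem.** The following are equivalent: 1. $G$ is online-perfect; 2. $f(2,G)=2$; 3. $G$ contains none of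 the following as an induced subgraph: $C_n$ for odd $n\ge 5$, $C_5^+$, $P_5^2$, the bull; 4. $G$ can be obtained (up to isomorphism) from a finite bipartite graph by successively cloning vertices (zero or more times). -/

import Mathlib

universe u

namespace TokenGame

/-! ### The online colouring game on tokens -/

/-- Spoiler's moves are recorded as the chronological list `s` of the vertices of `G` at which tokens
were placed; the tokens are the positions of the list.  In the token graph, two distinct tokens are
adjacent if and only if they lie on the same vertex or on adjacent vertices of `G`. -/
def tokenGraph {V : Type u} (G : SimpleGraph V) (s : List V) : SimpleGraph (Fin s.length) where
  Adj i j := i ≠ j ∧ (s.get i = s.get j ∨ G.Adj (s.get i) (s.get j))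
  symm := ⟨fun _ _ h => ⟨h.1.symm, h.2.imp Eq.symm fun h' => h'.symm⟩⟩
  loopless := ⟨fun _ h => h.1 rfl⟩

/-- A sequence of Spoiler moves is legal in the game of width `w` if the token graph has chromatic
number at most `w`.  (An initial segment of a legal sequence is then legal as well.) -/
def IsLegal {V : Type u} (G : SimpleGraph V) (w : ℕ) (s : List V) : Prop :=
  (tokenGraph G s).chromaticNumber ≤ (w : ℕ∞)

/-- A (deterministic) strategy for Algorithm: given the sequence of all tokens placed so far,
the last entry being the new token, it returns the colour of the new token.  The colours given to
the earlier tokens are themselves determined by the strategy, hence need not be an argument. -/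
abbrev Strategy (V : Type u) : Type u := List V → ℕ

/-- The colouring of the tokens that arises when Algorithm follows `A` against the moves `s`:
the colour of token `i` depends only on the tokens up to and including `i`. -/
def Strategy.coloring {V : Type u} (A : Strategy V) (s : List V) (i : Fin s.length) : ℕ :=
  A (s.take (i + 1))

/-- `A` is a valid strategy in the game of width `w` on `G`: against all legal play of Spoiler, the
colouring of the token graph it produces is proper. -/
def Strategy.IsValid {V : Type u} (A : Strategy V) (G : SimpleGraph V) (w : ℕ) : Prop :=
  ∀ s : List V, IsLegal G w s →
    ∀ i j : Fin s.length, (tokenGraph G s).Adj i j → A.coloring s i ≠ A.coloring s j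

/-- The number of distinct colours that `A` uses in the worst case in the game of width `w`. -/
noncomputable def Strategy.cost {V : Type u} (A : Strategy V) (G : SimpleGraph V) (w : ℕ) : ℕ∞ :=
  ⨆ s : {s : List V // IsLegal G w s}, (Set.range (A.coloring s.1)).encard

/-- The value `f(w, G)` of the game: the minimum, over all valid strategies of Algorithm, of the
number of colours used in the worst case. -/
noncomputable def value {V : Type u} (w : ℕ) (G : SimpleGraph V) : ℕ∞ :=
  ⨅ A : {A : Strategy V // A.IsValid G w}, A.1.cost G w

/-- `G` is online-perfect if `f(w, G) = w` for each `w`. -/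
def OnlinePerfect {V : Type u} (G : SimpleGraph V) : Prop :=
  ∀ w : ℕ, value w G = (w : ℕ∞)

/-! ### The forbidden induced subgraphs -/

/-- The distance `k`-power of `G`: distinct vertices are adjacent if and only if their distance
in `G` (infinite between different components) is at most `k`. -/
def distPower {V : Type u} (G : SimpleGraph V) (k : ℕ) : SimpleGraph V where
  Adj x y := x ≠ y ∧ G.edist x y ≤ (k : ℕ∞)
  symm := ⟨fun _ _ h => ⟨h.1.symm, by rw [SimpleGraph.edist_comm]; exact h.2⟩⟩
  loopless := ⟨fun _ h => h.1 rfl⟩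

/-- `C₅⁺`, the 5-cycle with one chord. -/
def C5plus : SimpleGraph (Fin 5) := SimpleGraph.cycleGraph 5 ⊔ SimpleGraph.edge 0 2

/-- `P₅²`, the square of the path on five vertices. -/
def P5sq : SimpleGraph (Fin 5) := distPower (SimpleGraph.pathGraph 5) 2

/-- The bull graph: the path `0 1 2 3 4` with the additional edge `1 3`, that is, the triangle
`1 2 3` with pendant edges `0 1` and `3 4`. -/
def bull : SimpleGraph (Fin 5) := SimpleGraph.pathGraph 5 ⊔ SimpleGraph.edge 1 3

/-! ### Cloning -/

/-- `x` and `y` have the same neighbours in `V(G) - {x, y}`. -/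
def Twins {V : Type u} (G : SimpleGraph V) (x y : V) : Prop :=
  ∀ z : V, z ≠ x → z ≠ y → (G.Adj x z ↔ G.Adj y z)

/-- `G'` is obtained (up to isomorphism) from `G` by cloning one vertex: `G'` has a vertex `x'` that
is a twin of some other vertex `x`, adjacent to it or not, and deleting `x'` from `G'` gives `G`. -/
def IsCloneOf {V W : Type u} (G' : SimpleGraph W) (G : SimpleGraph V) : Prop :=
  ∃ x x' : W, x ≠ x' ∧ Twins G' x x' ∧ Nonempty (G ≃g G'.induce {x'}ᶜ)

/-- `ObtainableByCloning H G`: the graph `G` is obtained, up to isomorphism, from `H` by cloning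
vertices one after the other, finitely many times (possibly not at all). -/
inductive ObtainableByCloning {U : Type u} (H : SimpleGraph U) :
    {V : Type u} → SimpleGraph V → Prop
  | start {V : Type u} (G : SimpleGraph V) : Nonempty (H ≃g G) → ObtainableByCloning H G
  | clone {V W : Type u} (G : SimpleGraph V) (G' : SimpleGraph W) :
      ObtainableByCloning H G → IsCloneOf G' G → ObtainableByCloning H G'

end TokenGame

/-!
The implications from online-perfection to `f(2, G) = 2`, and from there to the absence of the
forbidden subgraphs, are on Spoiler's side; the remaining two are structure theory and Algorithm's
strategies.

* *Spoiler.*  A strategy on `G` can be pulled back to an induced subgraph (`value_le_of_embedding`),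
  so it is enough that Spoiler forces three colours in width two on each forbidden graph.  With two
  colours, tokens at distance two that get a common neighbour must agree, and tokens at the
  ends of a path of length three must differ; Spoiler places nonadjacent tokens first and then
  completes whichever of these connections contradicts the colours chosen
  (`not_value_cycleGraph_le`, `not_value_C5plus_le`, `not_value_P5sq_le`, `not_value_bull_le`).

* *Structure.*  If `C₅⁺`, `P₅²` and the bull are not induced subgraphs of `G` and `G` contains
  a triangle, then `G` contains twins (`exists_twinsIn_of_triangle`), one of which can be removed.
  When no triangle is left, a shortest odd closed walk would be an induced odd cycle of length at
  least five (`exists_odd_hole`), so the graph is bipartite.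

* *Algorithm.*  On a bipartite graph, Algorithm uses the colours `0, 1, 2, …` in this order at each
  vertex of one side and `w - 1, w - 2, …` at each vertex of the other.  Adjacent vertices carry at
  most `w` tokens together, so the colours do not clash (`value_le_of_isBipartite`).  Cloning does not
  raise the value (`value_le_of_isCloneOf`): tokens on adjacent twins can be treated as tokens on one
  vertex (`value_le_of_map`), and nonadjacent twins can share the colours of one vertex, the `m`-th
  token on either of them getting the colour of the `m`-th token on that vertex in a simulated game
  (`value_comap_le`).
-/

namespace TokenGame

open SimpleGraph

variable {V W : Type*} {G : SimpleGraph V} {G' : SimpleGraph W} {w : ℕ}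

/-! ### Legal play -/

theorem isLegal_iff_colorable {s : List V} : IsLegal G w s ↔ (tokenGraph G s).Colorable w :=
  chromaticNumber_le_iff_colorable

theorem count_eq_card_filter [DecidableEq V] (s : List V) (v : V) :
    s.count v = (Finset.univ.filter fun i : Fin s.length => s.get i = v).card :=
  (Fin.card_filter_univ_eq_vector_get_eq_count v ⟨s, rfl⟩).symm

/-- Legality depends only on how many tokens lie on each vertex: the tokens can be coloured with
`w` colours exactly when the vertices can be given sets of colours, disjoint for adjacent vertices,
that are at least as large as the numbers of tokens. -/
theorem isLegal_iff_exists_finset [DecidableEq V] {s : List V} :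
    IsLegal G w s ↔ ∃ S : V → Finset (Fin w), (∀ v, s.count v ≤ (S v).card) ∧
      ∀ u v, G.Adj u v → Disjoint (S u) (S v) := by
  rw [isLegal_iff_colorable]
  constructor
  · rintro ⟨c⟩
    refine ⟨fun v => (Finset.univ.filter fun i : Fin s.length => s.get i = v).image c, ?_, ?_⟩
    · intro v
      rw [Finset.card_image_of_injOn, count_eq_card_filter]
      intro i hi j hj hij
      by_contra hne
      simp only [Finset.coe_filter, Finset.mem_univ, true_and, Set.mem_ofPred_eq] at hi hj
      exact c.valid (show (tokenGraph G s).Adj i j from ⟨hne, Or.inl (hi.trans hj.symm)⟩) hij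
    · intro u v huv
      rw [Finset.disjoint_left]
      intro x hx hy
      simp only [Finset.mem_image, Finset.mem_filter, Finset.mem_univ, true_and] at hx hy
      obtain ⟨i, rfl, rfl⟩ := hx
      obtain ⟨j, rfl, hij⟩ := hy
      have hne : j ≠ i := by
        rintro rfl
        exact G.loopless.irrefl _ huv
      exact c.valid (show (tokenGraph G s).Adj j i from ⟨hne, Or.inr huv.symm⟩) hij
  · rintro ⟨S, hS, hd⟩
    have hemb : ∀ v, Nonempty ({i : Fin s.length // s.get i = v} ↪ S v) := by
      intro v
      apply Function.Embedding.nonempty_of_card_le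
      rw [Fintype.card_coe, Fintype.card_subtype, ← count_eq_card_filter]
      exact hS v
    refine ⟨⟨fun i => ((hemb (s.get i)).some ⟨i, rfl⟩ : Fin w), ?_⟩⟩
    rintro i j ⟨hne, h⟩ hij
    have key : ∀ u v (hi : s.get i = u) (hj : s.get j = v), u = v →
        ((hemb u).some ⟨i, hi⟩ : Fin w) ≠ (hemb v).some ⟨j, hj⟩ := by
      rintro u _ hi hj rfl h
      exact hne (congrArg Subtype.val ((hemb u).some.injective (Subtype.ext h)))
    rcases h with h | h
    · exact key _ _ rfl rfl h hij
    · exact Finset.disjoint_left.1 (hd _ _ h) ((hemb (s.get i)).some ⟨i, rfl⟩).2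
        (hij ▸ ((hemb (s.get j)).some ⟨j, rfl⟩).2)

theorem IsLegal.count_le [DecidableEq V] {s : List V} (h : IsLegal G w s) (v : V) :
    s.count v ≤ w := by
  obtain ⟨S, hS, hd⟩ := isLegal_iff_exists_finset.1 h
  exact (hS v).trans ((Finset.card_le_univ _).trans (Fintype.card_fin w).le)

theorem IsLegal.count_add_count_le [DecidableEq V] {s : List V} (h : IsLegal G w s) {u v : V}
    (huv : G.Adj u v) : s.count u + s.count v ≤ w := by
  obtain ⟨S, hS, hd⟩ := isLegal_iff_exists_finset.1 h
  refine (add_le_add (hS u) (hS v)).trans ?_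
  rw [← Finset.card_union_of_disjoint (hd u v huv)]
  exact (Finset.card_le_univ _).trans (Fintype.card_fin w).le

theorem Strategy.IsValid.ne_take {A : Strategy V} (hA : A.IsValid G w) {s : List V}
    (hs : IsLegal G w s) {i j : ℕ} {u v : V} (hij : i ≠ j) (hi : s[i]? = some u)
    (hj : s[j]? = some v) (h : u = v ∨ G.Adj u v) : A (s.take (i + 1)) ≠ A (s.take (j + 1)) := by
  obtain ⟨hi', rfl⟩ := List.getElem?_eq_some_iff.1 hi
  obtain ⟨hj', rfl⟩ := List.getElem?_eq_some_iff.1 hj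
  exact hA s hs ⟨i, hi'⟩ ⟨j, hj'⟩ ⟨fun h => hij (congrArg Fin.val h), h⟩

theorem isValid_of_ne_take {A : Strategy V}
    (h : ∀ s, IsLegal G w s → ∀ (i j : ℕ) (u v : V), i < j → s[i]? = some u → s[j]? = some v →
      (u = v ∨ G.Adj u v) → A (s.take (i + 1)) ≠ A (s.take (j + 1))) : A.IsValid G w := by
  rintro s hs i j ⟨hne, hij⟩
  rcases lt_or_gt_of_ne hne with hlt | hlt
  · exact h s hs i j _ _ hlt (by simp) (by simp) hij
  · exact (h s hs j i _ _ hlt (by simp) (by simp)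
      (hij.imp Eq.symm fun h => h.symm)).symm

/-! ### Comparing the values of two graphs -/

/-- To bound `value w G'` by `value w G` it suffices to turn each valid strategy on `G` into a valid
one on `G'` which on each play uses only colours that appear on some legal play on `G`. -/
theorem value_le_value
    (h : ∀ A : Strategy V, A.IsValid G w → ∃ B : Strategy W, B.IsValid G' w ∧
      ∀ s, IsLegal G' w s → ∃ t, IsLegal G w t ∧
        Set.range (B.coloring s) ⊆ Set.range (A.coloring t)) :
    value w G' ≤ value w G := by
  refine le_iInf fun ⟨A, hA⟩ => ?_
  obtain ⟨B, hB, hBA⟩ := h A hA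
  refine iInf_le_of_le ⟨B, hB⟩ (iSup_le fun ⟨s, hs⟩ => ?_)
  obtain ⟨t, ht, hst⟩ := hBA s hs
  exact le_iSup_of_le (f := fun t : {t : List V // IsLegal G w t} =>
    (Set.range (A.coloring t.1)).encard) ⟨t, ht⟩ (Set.encard_le_encard hst)

/-- A map that preserves and reflects the relation "equal or adjacent" leaves token graphs
unchanged, so strategies can be pulled back along it. -/
theorem value_le_of_map (r : W → V)
    (hr : ∀ u v, (u = v ∨ G'.Adj u v) ↔ (r u = r v ∨ G.Adj (r u) (r v))) :
    value w G' ≤ value w G := by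
  have hlegal : ∀ s, IsLegal G' w s → IsLegal G w (s.map r) := by
    intro s hs
    rw [isLegal_iff_colorable] at hs ⊢
    obtain ⟨c⟩ := hs
    refine ⟨⟨fun i => c (i.cast (by simp)), ?_⟩⟩
    rintro i j ⟨hne, hij⟩
    refine c.valid ⟨fun h => hne (by simpa using h), (hr _ _).2 ?_⟩
    simpa using hij
  refine value_le_value fun A hA => ⟨fun s => A (s.map r), ?_, fun s hs => ⟨_, hlegal s hs, ?_⟩⟩
  · refine isValid_of_ne_take fun s hs i j u v hij hi hj huv => ?_
    rw [List.map_take, List.map_take]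
    exact hA.ne_take (hlegal s hs) hij.ne (by simp [hi]) (by simp [hj]) ((hr _ _).1 huv)
  · rintro _ ⟨i, rfl⟩
    exact ⟨i.cast (by simp), by simp [Strategy.coloring, List.map_take]⟩

theorem value_le_of_embedding (φ : G' ↪g G) : value w G' ≤ value w G :=
  value_le_of_map φ fun u v => by simp

/-! ### Simulating a game on a graph with false twins merged -/

section Simulation

variable [DecidableEq V] [DecidableEq W]

/-- The position of the token of `t` on `y` that has exactly `m` predecessors on `y`. -/
noncomputable def tokenIndex (t : List V) (y : V) (m : ℕ) : ℕ :=
  sInf {i | t[i]? = some y ∧ (t.take i).count y = m}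

theorem count_take_lt {t : List V} {y : V} {i j : ℕ} (hij : i < j) (hi : t[i]? = some y) :
    (t.take i).count y < (t.take j).count y := by
  have h : (t.take (i + 1)).count y = (t.take i).count y + 1 := by
    rw [List.take_add_one, hi]
    simp
  have := (List.take_prefix_take_left (l := t) (Nat.succ_le_of_lt hij)).sublist.count_le y
  simp only [Nat.succ_eq_add_one] at this
  omega

theorem tokenIndex_eq {t : List V} {y : V} {m i : ℕ} (hi : t[i]? = some y)
    (hm : (t.take i).count y = m) : tokenIndex t y m = i := by
  obtain ⟨h1, h2⟩ := Nat.sInf_mem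
    (⟨i, hi, hm⟩ : {i | t[i]? = some y ∧ (t.take i).count y = m}.Nonempty)
  rcases lt_trichotomy (tokenIndex t y m) i with h | h | h
  · have := count_take_lt h h1
    unfold tokenIndex at this
    omega
  · exact h
  · have := count_take_lt h hi
    unfold tokenIndex at this
    omega

theorem exists_tokenIndex {y : V} {m : ℕ} {t : List V} (h : m < t.count y) :
    ∃ i, t[i]? = some y ∧ (t.take i).count y = m := by
  induction t using List.reverseRecOn with
  | nil => simp at h
  | append_singleton t a ih =>
    by_cases hm : m < t.count y
    · obtain ⟨i, hi, hc⟩ := ih hm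
      have hlt : i < t.length := (List.getElem?_eq_some_iff.1 hi).1
      exact ⟨i, by rw [List.getElem?_append_left hlt, hi],
        by rw [List.take_append_of_le_length hlt.le, hc]⟩
    · have ha : a = y := by
        by_contra ha
        rw [List.count_append, List.count_singleton] at h
        simp [ha] at h
        omega
      subst ha
      refine ⟨t.length, by simp, ?_⟩
      simp at h ⊢
      omega

/-- The simulated play.  The history is listed with the most recent token first; a token on `v`
is passed on to `r v` unless the simulated play has enough tokens there already. -/
def simulateRev (r : W → V) : List W → List V
  | [] => []
  | v :: h => if (simulateRev r h).count (r v) < (v :: h).count v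
      then simulateRev r h ++ [r v] else simulateRev r h

/-- The simulated play, in chronological order. -/
def simulate (r : W → V) (s : List W) : List V := simulateRev r s.reverse

theorem simulate_append_singleton (r : W → V) (s : List W) (v : W) :
    simulate r (s ++ [v]) = if (simulate r s).count (r v) < s.count v + 1
      then simulate r s ++ [r v] else simulate r s := by
  simp [simulate, simulateRev]

theorem simulate_prefix (r : W → V) {s t : List W} (h : s <+: t) :
    simulate r s <+: simulate r t := by
  obtain ⟨l, rfl⟩ := h
  induction l using List.reverseRecOn with
  | nil => simp
  | append_singleton l a ih =>
    rw [← List.append_assoc, simulate_append_singleton]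
    split_ifs
    · exact ih.trans (List.prefix_append _ _)
    · exact ih

theorem count_le_count_simulate (r : W → V) (s : List W) (v : W) :
    s.count v ≤ (simulate r s).count (r v) := by
  induction s using List.reverseRecOn with
  | nil => simp
  | append_singleton s a ih =>
    rw [simulate_append_singleton]
    by_cases ha : a = v
    · subst ha
      split_ifs with h
      · simpa using ih
      · simpa using h
    · have : (s ++ [a]).count v = s.count v := by simp [ha]
      rw [this]
      split_ifs
      · exact ih.trans ((List.prefix_append _ _).sublist.count_le _)
      · exact ih

theorem exists_count_simulate (r : W → V) (s : List W) (y : V) :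
    (simulate r s).count y = 0 ∨
      ∃ v, r v = y ∧ (simulate r s).count y ≤ s.count v := by
  induction s using List.reverseRecOn with
  | nil => simp [simulate, simulateRev]
  | append_singleton s a ih =>
    rw [simulate_append_singleton]
    have mono : ∀ v, s.count v ≤ (s ++ [a]).count v := fun v =>
      (List.prefix_append _ _).sublist.count_le _
    split_ifs with h
    · by_cases ha : r a = y
      · subst ha
        exact Or.inr ⟨a, rfl, by simpa using h⟩
      · have : (simulate r s ++ [r a]).count y = (simulate r s).count y := by
          simp [ha]
        rw [this]
        exact ih.imp_right fun ⟨v, hv, hle⟩ => ⟨v, hv, hle.trans (mono v)⟩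
    · exact ih.imp_right fun ⟨v, hv, hle⟩ => ⟨v, hv, hle.trans (mono v)⟩

theorem IsLegal.simulate {r : W → V} {s : List W} (hs : IsLegal (G.comap r) w s) :
    IsLegal G w (simulate r s) := by
  obtain ⟨S, hS, hd⟩ := isLegal_iff_exists_finset.1 hs
  have key : ∀ y, ∃ T : Finset (Fin w), (TokenGame.simulate r s).count y ≤ T.card ∧
      (T = ∅ ∨ ∃ v, r v = y ∧ T = S v) := fun y => by
    rcases exists_count_simulate r s y with h | ⟨v, hv, h⟩
    · exact ⟨∅, by simp [h], Or.inl rfl⟩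
    · exact ⟨S v, h.trans (hS v), Or.inr ⟨v, hv, rfl⟩⟩
  choose T hT hTS using key
  refine isLegal_iff_exists_finset.2 ⟨T, hT, fun x y hxy => ?_⟩
  rcases hTS x with h | ⟨u, rfl, h⟩
  · simp [h]
  rcases hTS y with h' | ⟨v, rfl, h'⟩
  · simp [h']
  rw [h, h']
  exact hd u v hxy

/-- Each token of the real play is matched with a token of the simulated play, on the image vertex
and with the same number of predecessors there, that is present as soon as the real token is. -/
theorem exists_matched_token (r : W → V) {s : List W} {i : ℕ} {v : W} (hi : s[i]? = some v) :
    ∃ k, (simulate r s)[k]? = some (r v) ∧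
      ((simulate r s).take k).count (r v) = (s.take i).count v ∧
      (simulate r (s.take (i + 1))).take (k + 1) = (simulate r s).take (k + 1) ∧
      tokenIndex (simulate r (s.take (i + 1))) (r v) ((s.take i).count v) = k := by
  obtain ⟨k, hk, hc⟩ := exists_tokenIndex (t := simulate r (s.take (i + 1))) (y := r v)
    (m := (s.take i).count v)
    ((count_take_lt (Nat.lt_succ_self i) hi).trans_le (count_le_count_simulate r _ v))
  obtain ⟨l, hl⟩ := simulate_prefix r (List.take_prefix (i + 1) s)
  have hlt : k < (simulate r (s.take (i + 1))).length := (List.getElem?_eq_some_iff.1 hk).1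
  refine ⟨k, ?_, ?_, ?_, tokenIndex_eq hk hc⟩
  · rw [← hl, List.getElem?_append_left hlt, hk]
  · rw [← hl, List.take_append_of_le_length hlt.le, hc]
  · rw [← hl, List.take_append_of_le_length hlt]

/-- The strategy on `G.comap r` that follows `A` on the simulated play and gives a new token the
colour of the token matched with it. -/
noncomputable def Strategy.lift (A : Strategy V) (r : W → V) : Strategy W := fun s =>
  match s.getLast? with
  | none => 0
  | some v => A ((TokenGame.simulate r s).take
      (tokenIndex (TokenGame.simulate r s) (r v) (s.dropLast.count v) + 1))

theorem Strategy.lift_take (A : Strategy V) (r : W → V) {s : List W} {i : ℕ} {v : W}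
    (hi : s[i]? = some v) :
    A.lift r (s.take (i + 1)) = A ((TokenGame.simulate r (s.take (i + 1))).take
      (tokenIndex (TokenGame.simulate r (s.take (i + 1))) (r v) ((s.take i).count v) + 1)) := by
  have h : s.take (i + 1) = s.take i ++ [v] := by rw [List.take_add_one, hi]; rfl
  simp [Strategy.lift, h]

end Simulation

/-- Vertices with the same image under `r` are false twins in `G.comap r`; they can share the
colours of a single vertex of `G`. -/
theorem value_comap_le (r : W → V) : value w (G.comap r) ≤ value w G := by
  classical
  refine value_le_value fun A hA => ⟨A.lift r, ?_, fun s hs => ⟨_, hs.simulate, ?_⟩⟩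
  · refine isValid_of_ne_take fun s hs i j u v hij hi hj huv => ?_
    obtain ⟨k, hk, hkc, hkt, hki⟩ := exists_matched_token r hi
    obtain ⟨l, hl, hlc, hlt, hli⟩ := exists_matched_token r hj
    rw [A.lift_take r hi, A.lift_take r hj, hki, hli, hkt, hlt]
    refine hA.ne_take hs.simulate ?_ hk hl (huv.imp (congrArg r) id)
    rintro rfl
    have hr : r u = r v := by simpa [hk] using hl
    rcases huv with rfl | huv
    · have := count_take_lt hij hi
      omega
    · rw [comap_adj, hr] at huv
      exact G.loopless.irrefl _ huv
  · rintro _ ⟨i, rfl⟩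
    have hi : s[(i : ℕ)]? = some (s.get i) := by simp
    obtain ⟨k, hk, hkc, hkt, hki⟩ := exists_matched_token r hi
    refine ⟨⟨k, (List.getElem?_eq_some_iff.1 hk).1⟩, ?_⟩
    simp only [Strategy.coloring]
    rw [A.lift_take r hi, hki, hkt]

/-! ### Bipartite graphs and clones -/

theorem le_value [Nonempty V] (G : SimpleGraph V) (w : ℕ) : (w : ℕ∞) ≤ value w G := by
  obtain ⟨v⟩ := ‹Nonempty V›
  have hs : IsLegal G w (List.replicate w v) := by
    rw [isLegal_iff_colorable]
    simpa using (tokenGraph G (List.replicate w v)).colorable_of_fintype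
  refine le_iInf fun ⟨A, hA⟩ => ?_
  refine le_iSup_of_le (f := fun t : {t : List V // IsLegal G w t} =>
    (Set.range (A.coloring t.1)).encard) ⟨_, hs⟩ ?_
  have hinj : Function.Injective (A.coloring (List.replicate w v)) := by
    intro i j hij
    by_contra hne
    exact hA _ hs i j ⟨hne, Or.inl (by simp)⟩ hij
  rw [← Set.image_univ, hinj.encard_image, Set.encard_univ]
  simp

/-- On a bipartite graph, one side is coloured from below and the other from above: the tokens
on two adjacent vertices together number at most `w`, so the two ranges do not meet. -/
theorem value_le_of_isBipartite (h : G.IsBipartite) : value w G ≤ w := by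
  classical
  obtain ⟨c⟩ := h
  let A : Strategy V := fun s => match s.getLast? with
    | none => 0
    | some v => if c v = 0 then s.dropLast.count v else w - 1 - s.dropLast.count v
  have hA : ∀ {s : List V} {i : ℕ} {v : V}, s[i]? = some v → A (s.take (i + 1)) =
      if c v = 0 then (s.take i).count v else w - 1 - (s.take i).count v := by
    intro s i v hi
    have h : s.take (i + 1) = s.take i ++ [v] := by rw [List.take_add_one, hi]; rfl
    simp [A, h]
  have hlt : ∀ {s : List V} {i : ℕ} {v : V}, s[i]? = some v → (s.take i).count v < s.count v := by
    intro s i v hi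
    have := count_take_lt (List.getElem?_eq_some_iff.1 hi).1 hi
    simpa using this
  have hvalid : A.IsValid G w := by
    refine isValid_of_ne_take fun s hs i j u v hij hi hj huv => ?_
    rw [hA hi, hA hj]
    have hi' := hlt hi
    have hj' := hlt hj
    rcases huv with rfl | huv
    · have := count_take_lt hij hi
      have := hs.count_le u
      split_ifs <;> omega
    · have := hs.count_add_count_le huv
      have hc := c.valid huv
      split_ifs with h1 h2 h2
      · exact absurd (h1.trans h2.symm) hc
      · omega
      · omega
      · exact absurd (by omega) hc
  refine iInf_le_of_le ⟨A, hvalid⟩ (iSup_le fun ⟨s, hs⟩ => ?_)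
  have hsub : Set.range (A.coloring s) ⊆ (Finset.range w : Set ℕ) := by
    rintro _ ⟨i, rfl⟩
    have hi : s[(i : ℕ)]? = some (s.get i) := by simp
    have := hlt hi
    have := hs.count_le (s.get i)
    simp only [Strategy.coloring, hA hi, Finset.coe_range, Set.mem_Iio]
    split_ifs <;> omega
  refine (Set.encard_le_encard hsub).trans ?_
  rw [Set.encard_coe_eq_coe_finsetCard, Finset.card_range]

theorem value_le_of_isCloneOf {V W : Type u} {G : SimpleGraph V} {G' : SimpleGraph W}
    (h : IsCloneOf G' G) : value w G' ≤ value w G := by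
  classical
  obtain ⟨x, x', hne, htw, ⟨φ⟩⟩ := h
  refine le_trans ?_ (value_le_of_embedding (w := w) φ.symm.toEmbedding)
  let r : W → ({x'}ᶜ : Set W) := fun v => if h : v = x' then ⟨x, hne⟩ else ⟨v, h⟩
  have hr : ∀ v, (r v : W) = if v = x' then x else v := fun v => by
    by_cases h : v = x' <;> simp [r, h]
  by_cases hadj : G'.Adj x x'
  · refine value_le_of_map r fun u v => ?_
    rw [Subtype.ext_iff, induce_adj, hr, hr]
    have := htw u
    have := htw v
    split_ifs <;> grind [SimpleGraph.adj_comm]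
  · have : G' = (G'.induce {x'}ᶜ).comap r := by
      ext u v
      rw [comap_adj, induce_adj, hr, hr]
      have := htw u
      have := htw v
      split_ifs <;> grind [SimpleGraph.adj_comm, SimpleGraph.irrefl]
    conv_lhs => rw [this]
    exact value_comap_le r

theorem ObtainableByCloning.value_le {U V : Type u} {H : SimpleGraph U} {G : SimpleGraph V}
    (hH : H.IsBipartite) (h : ObtainableByCloning H G) : value w G ≤ w := by
  induction h with
  | start G hG =>
    obtain ⟨φ⟩ := hG
    exact (value_le_of_embedding φ.symm.toEmbedding).trans (value_le_of_isBipartite hH)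
  | clone G G' _ hclone ih => exact (value_le_of_isCloneOf hclone).trans ih

/-! ### Adjacency in the forbidden graphs -/

theorem cycleGraph_adj_iff {n : ℕ} (hn : 2 ≤ n) {u v : Fin n} :
    (cycleGraph n).Adj u v ↔ (u : ℕ) + 1 = v ∨ (v : ℕ) + 1 = u ∨
      ((u : ℕ) = 0 ∧ (v : ℕ) + 1 = n) ∨ ((v : ℕ) = 0 ∧ (u : ℕ) + 1 = n) := by
  rw [cycleGraph_adj']
  have hu := u.isLt
  have hv := v.isLt
  rcases lt_trichotomy u v with h | h | h
  · rw [Fin.coe_sub_iff_lt.2 h, Fin.coe_sub_iff_le.2 h.le]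
    have : (u : ℕ) < v := h
    omega
  · subst h
    rw [Fin.coe_sub_iff_le.2 le_rfl]
    omega
  · rw [Fin.coe_sub_iff_lt.2 h, Fin.coe_sub_iff_le.2 h.le]
    have : (v : ℕ) < u := h
    omega

theorem edist_le_two_iff {x y : V} :
    G.edist x y ≤ 2 ↔ x = y ∨ G.Adj x y ∨ ∃ z, G.Adj x z ∧ G.Adj z y := by
  constructor
  · intro h
    obtain ⟨p, hp⟩ := exists_walk_of_edist_ne_top (ne_top_of_le_ne_top (by simp) h)
    rw [← hp] at h
    have h2 : p.length ≤ 2 := by exact_mod_cast h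
    match p, h2 with
    | .nil, _ => exact Or.inl rfl
    | .cons h .nil, _ => exact Or.inr (Or.inl h)
    | .cons h (.cons h' .nil), _ => exact Or.inr (Or.inr ⟨_, h, h'⟩)
    | .cons _ (.cons _ (.cons _ _)), h => simp at h
  · rintro (rfl | h | ⟨z, h, h'⟩)
    · simp
    · exact (edist_le h.toWalk).trans (by simp)
    · exact (edist_le (Walk.cons h h'.toWalk)).trans (by simp)

theorem C5plus_adj_iff (i j : Fin 5) : C5plus.Adj i j ↔
    (i, j) ∈ [(0, 1), (1, 0), (1, 2), (2, 1), (2, 3), (3, 2), (3, 4), (4, 3), (4, 0), (0, 4),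
      (0, 2), (2, 0)] := by
  simp only [C5plus, sup_adj, edge_adj, cycleGraph_adj']
  revert i j
  decide

theorem bull_adj_iff (i j : Fin 5) : bull.Adj i j ↔
    (i, j) ∈ [(0, 1), (1, 0), (1, 2), (2, 1), (2, 3), (3, 2), (3, 4), (4, 3), (1, 3), (3, 1)] := by
  simp only [bull, sup_adj, edge_adj, pathGraph_adj]
  revert i j
  decide

theorem P5sq_adj_iff (i j : Fin 5) : P5sq.Adj i j ↔
    (i, j) ∈ [(0, 1), (1, 0), (1, 2), (2, 1), (2, 3), (3, 2), (3, 4), (4, 3), (0, 2), (2, 0),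
      (1, 3), (3, 1), (2, 4), (4, 2)] := by
  simp only [P5sq, distPower, Nat.cast_ofNat, edist_le_two_iff, pathGraph_adj]
  revert i j
  decide

instance : DecidableRel C5plus.Adj := fun i j => decidable_of_iff _ (C5plus_adj_iff i j).symm

instance : DecidableRel bull.Adj := fun i j => decidable_of_iff _ (bull_adj_iff i j).symm

instance : DecidableRel P5sq.Adj := fun i j => decidable_of_iff _ (P5sq_adj_iff i j).symm

/-! ### Spoiler's strategies in the game of width two -/

theorem exists_valid_cost_le {n : ℕ} (h : value w G ≤ n) :
    ∃ A : Strategy V, A.IsValid G w ∧ A.cost G w ≤ n := by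
  have : Nonempty {A : Strategy V // A.IsValid G w} := by
    by_contra hne
    rw [not_nonempty_iff] at hne
    rw [value, iInf_of_empty] at h
    exact absurd (top_le_iff.1 h) (ENat.natCast_ne_top n)
  obtain ⟨⟨A, hA⟩, hAc⟩ := ENat.exists_eq_iInf
    fun A : {A : Strategy V // A.IsValid G w} => A.1.cost G w
  exact ⟨A, hA, hAc.trans_le h⟩

/-- With only two colours, a common neighbour of two tokens forces them to have the same colour. -/
theorem Strategy.IsValid.eq_of_common_neighbor {A : Strategy V} (hA : A.IsValid G w)
    (hc : A.cost G w ≤ 2) {s : List V} (hs : IsLegal G w s) {u v z : V} (i j k : ℕ)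
    (hi : s[i]? = some u) (hj : s[j]? = some v) (hk : s[k]? = some z)
    (huz : G.Adj u z) (hvz : G.Adj v z) : A (s.take (i + 1)) = A (s.take (j + 1)) := by
  have hik : i ≠ k := by
    rintro rfl
    rw [hi] at hk
    exact huz.ne (Option.some.inj hk)
  have hjk : j ≠ k := by
    rintro rfl
    rw [hj] at hk
    exact hvz.ne (Option.some.inj hk)
  have h1 := hA.ne_take hs hik hi hk (Or.inr huz)
  have h2 := hA.ne_take hs hjk hj hk (Or.inr hvz)
  by_contra h3
  have hcard : (Set.range (A.coloring s)).encard ≤ 2 :=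
    (le_iSup (fun t : {t : List V // IsLegal G w t} => (Set.range (A.coloring t.1)).encard)
      ⟨s, hs⟩).trans hc
  have hmem : ∀ {l : ℕ} {x : V}, s[l]? = some x →
      A (s.take (l + 1)) ∈ Set.range (A.coloring s) := fun {l x} hl =>
    ⟨⟨l, (List.getElem?_eq_some_iff.1 hl).1⟩, rfl⟩
  have hsub : {A (s.take (i + 1)), A (s.take (j + 1)), A (s.take (k + 1))} ⊆
      Set.range (A.coloring s) := by
    rintro c (rfl | rfl | rfl)
    exacts [hmem hi, hmem hj, hmem hk]
  have h := (Set.encard_le_encard hsub).trans hcard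
  rw [Set.encard_eq_three.2 ⟨_, _, _, h3, h1, h2, rfl⟩] at h
  exact absurd h (by decide)

/-- A play on distinct vertices is legal if the subgraph that they induce is `w`-colourable. -/
theorem isLegal_of_nodup (c : V → Fin w) {s : List V} (hs : s.Nodup)
    (hc : ∀ x ∈ s, ∀ y ∈ s, G.Adj x y → c x ≠ c y) : IsLegal G w s := by
  rw [isLegal_iff_colorable]
  refine ⟨⟨fun i => c (s.get i), ?_⟩⟩
  rintro i j ⟨hne, h | h⟩
  · exact absurd (hs.injective_get h) hne
  · exact hc _ (List.get_mem _ _) _ (List.get_mem _ _) h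

/-- Spoiler plays the ends of the two pendant edges.  If they get the same colour, the path joining
them through the triangle cannot be completed; otherwise the third vertex of the triangle disagrees
with one of them, and their common neighbour needs a third colour. -/
theorem not_value_bull_le : ¬ value 2 bull ≤ 2 := by
  intro h
  obtain ⟨A, hA, hc⟩ := exists_valid_cost_le (n := 2) h
  have l1 : IsLegal bull 2 [0, 4, 1, 3] := isLegal_of_nodup ![0, 1, 0, 0, 1] (by decide) (by decide)
  have l2 : IsLegal bull 2 [0, 4, 2, 1] := isLegal_of_nodup ![0, 1, 0, 1, 0] (by decide) (by decide)
  have l3 : IsLegal bull 2 [0, 4, 2, 3] := isLegal_of_nodup ![0, 1, 0, 1, 0] (by decide) (by decide)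
  have e1 : A [0] = A [0, 4, 1, 3] :=
    hA.eq_of_common_neighbor hc l1 0 3 2 rfl rfl rfl (by decide) (by decide)
  have e2 : A [0, 4] ≠ A [0, 4, 1, 3] :=
    hA.ne_take l1 (i := 1) (j := 3) (by decide) rfl rfl (by decide)
  have e3 : A [0] = A [0, 4, 2] :=
    hA.eq_of_common_neighbor hc l2 0 2 3 rfl rfl rfl (by decide) (by decide)
  have e4 : A [0, 4] = A [0, 4, 2] :=
    hA.eq_of_common_neighbor hc l3 1 2 3 rfl rfl rfl (by decide) (by decide)
  exact e2 (e4.trans (e3.symm.trans e1))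

/-- Spoiler plays `1` and `3`: their common neighbour `2` forces equal colours, and the path
`1 0 4 3` forces different ones. -/
theorem not_value_C5plus_le : ¬ value 2 C5plus ≤ 2 := by
  intro h
  obtain ⟨A, hA, hc⟩ := exists_valid_cost_le (n := 2) h
  have l1 : IsLegal C5plus 2 [1, 3, 2] := isLegal_of_nodup ![0, 0, 1, 0, 0] (by decide) (by decide)
  have l2 : IsLegal C5plus 2 [1, 3, 4, 0] :=
    isLegal_of_nodup ![1, 0, 0, 1, 0] (by decide) (by decide)
  have e1 : A [1] = A [1, 3] :=
    hA.eq_of_common_neighbor hc l1 0 1 2 rfl rfl rfl (by decide) (by decide)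
  have e2 : A [1] = A [1, 3, 4] :=
    hA.eq_of_common_neighbor hc l2 0 2 3 rfl rfl rfl (by decide) (by decide)
  have e3 : A [1, 3] ≠ A [1, 3, 4] :=
    hA.ne_take l2 (i := 1) (j := 2) (by decide) rfl rfl (by decide)
  exact e3 (e1.symm.trans e2)

/-- Spoiler plays `0` and `4`: their common neighbour `2` forces equal colours, and the path
`0 1 3 4` forces different ones. -/
theorem not_value_P5sq_le : ¬ value 2 P5sq ≤ 2 := by
  intro h
  obtain ⟨A, hA, hc⟩ := exists_valid_cost_le (n := 2) h
  have l1 : IsLegal P5sq 2 [0, 4, 2] := isLegal_of_nodup ![0, 0, 1, 0, 0] (by decide) (by decide)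
  have l2 : IsLegal P5sq 2 [0, 4, 1, 3] :=
    isLegal_of_nodup ![0, 1, 0, 0, 1] (by decide) (by decide)
  have e1 : A [0] = A [0, 4] :=
    hA.eq_of_common_neighbor hc l1 0 1 2 rfl rfl rfl (by decide) (by decide)
  have e2 : A [0] = A [0, 4, 1, 3] :=
    hA.eq_of_common_neighbor hc l2 0 3 2 rfl rfl rfl (by decide) (by decide)
  have e3 : A [0, 4] ≠ A [0, 4, 1, 3] :=
    hA.ne_take l2 (i := 1) (j := 3) (by decide) rfl rfl (by decide)
  exact e3 (e1.symm.trans e2)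

/-- Distinct vertices of an odd cycle that avoid some odd-numbered vertex form a legal play:
without that vertex the cycle becomes a path. -/
theorem isLegal_cycleGraph_of_avoid {k m : ℕ} (hm : m < k) {s : List (Fin (2 * k + 1))}
    (hs : s.Nodup) (hav : ∀ x ∈ s, (x : ℕ) ≠ 2 * m + 1) :
    IsLegal (cycleGraph (2 * k + 1)) 2 s := by
  let c : Fin (2 * k + 1) → ℕ := fun x => if (x : ℕ) < 2 * m + 1 then (x : ℕ) else (x : ℕ) + 1
  refine isLegal_of_nodup (fun x => Fin.ofNat 2 (c x)) hs ?_
  intro x hx y hy hxy h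
  rw [cycleGraph_adj_iff (by omega)] at hxy
  have h1 := hav x hx
  have h2 := hav y hy
  have h3 : c x % 2 = c y % 2 := congrArg Fin.val h
  simp only [c] at h3
  split_ifs at h3 <;> omega

/-- Spoiler plays the even-numbered vertices `0, 2, …, 2k` of the cycle of length `2k + 1`.
The first and the last are adjacent, so some two consecutive ones get different colours, and then
their common neighbour needs a third colour. -/
theorem not_value_cycleGraph_le {n : ℕ} (hn : 5 ≤ n) (hodd : Odd n) :
    ¬ value 2 (cycleGraph n) ≤ 2 := by
  obtain ⟨k, rfl⟩ := hodd
  have hk : 2 ≤ k := by omega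
  intro h
  obtain ⟨A, hA, hc⟩ := exists_valid_cost_le (n := 2) h
  let f : ℕ → Fin (2 * k + 1) := fun j => Fin.ofNat _ (2 * j)
  have hf : ∀ {j}, j ≤ k → (f j : ℕ) = 2 * j := fun {j} hj =>
    Nat.mod_eq_of_lt (by omega)
  let E : List (Fin (2 * k + 1)) := (List.range (k + 1)).map f
  have hE : ∀ x ∈ E, (x : ℕ) % 2 = 0 := by
    intro x hx
    obtain ⟨j, hj, rfl⟩ := List.mem_map.1 hx
    rw [List.mem_range] at hj
    rw [hf (by omega)]
    omega
  have hEn : E.Nodup := by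
    refine List.Nodup.map_on ?_ List.nodup_range
    intro x hx y hy hxy
    rw [List.mem_range] at hx hy
    have := congrArg Fin.val hxy
    rw [hf (by omega), hf (by omega)] at this
    omega
  have hEl : E.length = k + 1 := by simp [E]
  have hEi : ∀ {j}, j ≤ k → E[j]? = some (f j) := fun {j} hj => by
    simp [E, show j < k + 1 by omega]
  have hends : A (E.take 1) ≠ A (E.take (k + 1)) := by
    refine hA.ne_take (isLegal_cycleGraph_of_avoid (m := 0) (by omega) hEn ?_) (i := 0) (j := k)
      (by omega) (hEi (by omega)) (hEi le_rfl) (Or.inr ?_)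
    · intro x hx
      have := hE x hx
      omega
    · rw [cycleGraph_adj_iff (by omega), hf (Nat.zero_le k), hf le_rfl]
      omega
  have hstep : ∀ i < k, A (E.take (i + 1)) = A (E.take (i + 1 + 1)) := by
    intro i hi
    let o : Fin (2 * k + 1) := ⟨2 * i + 1, by omega⟩
    -- As `k ≥ 2`, some odd-numbered vertex `2 * m + 1` stays free.
    obtain ⟨m, hm, hmi⟩ : ∃ m < k, m ≠ i := by
      by_cases h0 : i = 0
      · exact ⟨1, by omega, by omega⟩
      · exact ⟨0, by omega, by omega⟩
    have hl : IsLegal (cycleGraph (2 * k + 1)) 2 (E ++ [o]) := by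
      refine isLegal_cycleGraph_of_avoid hm ?_ ?_
      · rw [← List.concat_eq_append]
        refine hEn.concat fun ho => ?_
        have := hE _ ho
        simp only [o] at this
        omega
      · intro x hx
        rcases List.mem_append.1 hx with hx | hx
        · have := hE x hx
          omega
        · rw [List.mem_singleton.1 hx]
          simp only [o]
          omega
    have key := hA.eq_of_common_neighbor hc hl i (i + 1) (k + 1) (z := o)
      ((List.getElem?_append_left (by omega)).trans (hEi (by omega)))
      ((List.getElem?_append_left (by omega)).trans (hEi (by omega)))
      (by rw [← hEl]; simp)
      (by rw [cycleGraph_adj_iff (by omega), hf (by omega)]; simp [o])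
      (by rw [cycleGraph_adj_iff (by omega), hf (by omega)]; simp only [o]; omega)
    rwa [List.take_append_of_le_length (by omega), List.take_append_of_le_length (by omega)] at key
  have hall : ∀ i ≤ k, A (E.take 1) = A (E.take (i + 1)) := by
    intro i
    induction i with
    | zero => exact fun _ => rfl
    | succ i ih => exact fun hi => (ih (by omega)).trans (hstep i (by omega))
  exact hends (hall k le_rfl)

/-- A graph of width-two value at most two contains no graph of larger width-two value as an
induced subgraph. -/
theorem not_isIndContained_of_value_le {U : Type*} {F : SimpleGraph U} (hG : value 2 G ≤ 2)
    (hF : ¬ value 2 F ≤ 2) : ¬ F.IsIndContained G :=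
  fun ⟨φ⟩ => hF ((value_le_of_embedding φ).trans hG)

/-! ### Exhibiting forbidden subgraphs -/

/-- If no two vertices of `F` have the same neighbours, then maps that preserve and reflect
adjacency are injective. -/
theorem isIndContained_of_adj_iff {U : Type*} {F : SimpleGraph U}
    (hF : ∀ i j, (∀ k, F.Adj i k ↔ F.Adj j k) → i = j) (f : U → V)
    (hf : ∀ i j, G.Adj (f i) (f j) ↔ F.Adj i j) : F.IsIndContained G :=
  ⟨⟨⟨f, fun i j h => hF i j fun k => by rw [← hf, ← hf, h]⟩, hf _ _⟩⟩

theorem isIndContained_bull {a b c d e : V} (hab : G.Adj a b) (hac : G.Adj a c) (hbc : G.Adj b c)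
    (had : G.Adj a d) (hbe : G.Adj b e) (hbd : ¬ G.Adj b d) (hcd : ¬ G.Adj c d)
    (hae : ¬ G.Adj a e) (hce : ¬ G.Adj c e) (hde : ¬ G.Adj d e) : bull.IsIndContained G := by
  refine isIndContained_of_adj_iff (by decide) ![d, a, c, b, e] fun i j => ?_
  rw [bull_adj_iff]
  fin_cases i <;> fin_cases j <;> simp [*, adj_comm]

theorem isIndContained_C5plus {a b c d e : V} (hab : G.Adj a b) (hac : G.Adj a c)
    (hbc : G.Adj b c) (had : G.Adj a d) (hbe : G.Adj b e) (hbd : ¬ G.Adj b d) (hcd : ¬ G.Adj c d)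
    (hae : ¬ G.Adj a e) (hce : ¬ G.Adj c e) (hde : G.Adj d e) : C5plus.IsIndContained G := by
  refine isIndContained_of_adj_iff (by decide) ![a, c, b, e, d] fun i j => ?_
  rw [C5plus_adj_iff]
  fin_cases i <;> fin_cases j <;> simp [*, adj_comm]

/-- `P₅²` is the path `b c d e` together with a vertex `a` adjacent to all of it. -/
theorem isIndContained_P5sq {a b c d e : V} (hab : G.Adj a b) (hac : G.Adj a c)
    (had : G.Adj a d) (hae : G.Adj a e) (hbc : G.Adj b c) (hcd : G.Adj c d) (hde : G.Adj d e)
    (hbd : ¬ G.Adj b d) (hbe : ¬ G.Adj b e) (hce : ¬ G.Adj c e) : P5sq.IsIndContained G := by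
  refine isIndContained_of_adj_iff (by decide) ![b, c, a, d, e] fun i j => ?_
  rw [P5sq_adj_iff]
  fin_cases i <;> fin_cases j <;> simp [*, adj_comm]

/-! ### Twins in graphs with a triangle -/

/-- `x` and `y` have the same neighbours in the vertex set `M`, apart from themselves. -/
def TwinsIn (G : SimpleGraph V) (M : Finset V) (x y : V) : Prop :=
  ∀ z ∈ M, z ≠ x → z ≠ y → (G.Adj x z ↔ G.Adj y z)

theorem exists_of_not_twinsIn {M : Finset V} {x y : V} (h : ¬ TwinsIn G M x y) :
    ∃ z ∈ M, z ≠ x ∧ z ≠ y ∧ ((G.Adj x z ∧ ¬ G.Adj y z) ∨ (G.Adj y z ∧ ¬ G.Adj x z)) := by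
  unfold TwinsIn at h
  push Not at h
  grind

/-- If a triangle lies in `M` and `M` contains no twins, then `M` contains a paw, that is, a triangle
with a pendant edge: otherwise a vertex telling apart `b` and `c` is joined to `a`, which
gives a diamond, and a vertex telling apart the two ends of the diamond gives a paw or a `P₅²`. -/
theorem exists_paw {M : Finset V} (hP : ¬ P5sq.IsIndContained G)
    (hM : ∀ x ∈ M, ∀ y ∈ M, x ≠ y → ¬ TwinsIn G M x y) {a b c : V} (ha : a ∈ M) (hb : b ∈ M)
    (hc : c ∈ M) (hab : G.Adj a b) (hac : G.Adj a c) (hbc : G.Adj b c) :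
    ∃ a ∈ M, ∃ b ∈ M, ∃ c ∈ M, ∃ d ∈ M, G.Adj a b ∧ G.Adj a c ∧ G.Adj b c ∧ G.Adj a d ∧
      ¬ G.Adj b d ∧ ¬ G.Adj c d := by
  by_contra hno
  push Not at hno
  wlog h : ∃ e ∈ M, e ≠ c ∧ G.Adj b e ∧ ¬ G.Adj c e generalizing b c
  · obtain ⟨e, he, heb, hec, h1 | h1⟩ := exists_of_not_twinsIn (hM b hb c hc hbc.ne)
    · exact h ⟨e, he, hec, h1⟩
    · exact this hc hb hac hab hbc.symm ⟨e, he, heb, h1⟩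
  obtain ⟨e, he, hec, hbe, hce⟩ := h
  have hae : G.Adj a e := by
    by_contra hae
    exact hce (hno b hb a ha c hc e he hab.symm hbc hac hbe hae)
  -- From here on `c` and `e` play symmetric roles.
  wlog h : ∃ f ∈ M, f ≠ e ∧ G.Adj c f ∧ ¬ G.Adj e f generalizing c e
  · obtain ⟨f, hf, hfc, hfe, h1 | h1⟩ := exists_of_not_twinsIn (hM c hc e he hec.symm)
    · exact h ⟨f, hf, hfe, h1⟩
    · exact this he hae hbe c hc hec.symm hbc (fun h => hce h.symm) hac ⟨f, hf, hfc, h1⟩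
  obtain ⟨f, hf, hfe, hcf, hef⟩ := h
  by_cases haf : G.Adj a f
  · by_cases hbf : G.Adj b f
    · exact hef (hno a ha c hc f hf e he hac haf hcf hae hce).symm
    · exact hP (isIndContained_P5sq hae hab hac haf hbe.symm hbc hcf (fun h => hce h.symm) hef hbf)
  · by_cases hbf : G.Adj b f
    · exact hP (isIndContained_P5sq hbe hab.symm hbc hbf hae.symm hac hcf (fun h => hce h.symm)
        hef haf)
    · exact hbf (hno c hc a ha b hb f hf hac.symm hbc.symm hab hcf haf)

/-- In a triangle-free set `K` on which `G` has no induced path on four vertices, two neighbours of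
the same vertex are twins. -/
theorem twinsIn_of_common_neighbor {K : Finset V} {b x y : V} (hb : b ∈ K) (hx : x ∈ K)
    (hy : y ∈ K) (hbx : G.Adj b x) (hby : G.Adj b y)
    (hK : ∀ p ∈ K, ∀ q ∈ K, ∀ r ∈ K, G.Adj p q → G.Adj p r → ¬ G.Adj q r)
    (hP : ∀ p ∈ K, ∀ q ∈ K, ∀ r ∈ K, ∀ t ∈ K, G.Adj p q → G.Adj q r → G.Adj r t →
      G.Adj p r ∨ G.Adj p t ∨ G.Adj q t) :
    TwinsIn G K x y := by
  have key : ∀ x ∈ K, ∀ y ∈ K, G.Adj b x → G.Adj b y → ∀ z ∈ K, G.Adj x z → G.Adj y z := by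
    intro x hx y hy hbx hby z hz hxz
    rcases hP z hz x hx b hb y hy hxz.symm hbx.symm hby with h | h | h
    · exact absurd hxz (hK b hb x hx z hz hbx h.symm)
    · exact h.symm
    · exact absurd h (hK b hb x hx y hy hbx hby)
  exact fun z hz _ _ => ⟨key x hx y hy hbx hby z hz, key y hy x hx hby hbx z hz⟩

/-- A graph without induced `C₅⁺`, `P₅²` and bull has twins in each vertex set that contains
a triangle.  Given a paw with triangle `a b c` and pendant edge `a d`, let `K` be the component
containing `b` and `c` of the graph on the neighbours of `a` that are not neighbours of `d`.
A vertex outside `K` that told apart two adjacent vertices of `K` would create one of the three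
forbidden graphs, so twins within `K` are twins.  They exist by induction if `K` contains
a triangle, and otherwise since `K` is a complete bipartite graph. -/
theorem exists_twinsIn_of_triangle (hC : ¬ C5plus.IsIndContained G)
    (hP : ¬ P5sq.IsIndContained G) (hB : ¬ bull.IsIndContained G) (M : Finset V) {a b c : V}
    (ha : a ∈ M) (hb : b ∈ M) (hc : c ∈ M) (hab : G.Adj a b) (hac : G.Adj a c)
    (hbc : G.Adj b c) : ∃ x ∈ M, ∃ y ∈ M, x ≠ y ∧ TwinsIn G M x y := by
  classical
  induction M using Finset.strongInduction generalizing a b c with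
  | H M ih =>
  by_contra! hM
  obtain ⟨a, ha, b, hb, c, hc, d, hd, hab, hac, hbc, had, hbd, hcd⟩ :=
    exists_paw hP hM ha hb hc hab hac hbc
  let R : V → V → Prop := fun x y => G.Adj x y ∧ y ∈ M ∧ G.Adj a y ∧ ¬ G.Adj y d
  let K : Finset V := M.filter (Relation.ReflTransGen R b)
  have hKM : ∀ {x}, x ∈ K → x ∈ M := fun hx => (Finset.mem_filter.1 hx).1
  have hbK : b ∈ K := Finset.mem_filter.2 ⟨hb, .refl⟩
  have hstep : ∀ {x y}, x ∈ K → R x y → y ∈ K := fun hx hxy =>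
    Finset.mem_filter.2 ⟨hxy.2.1, (Finset.mem_filter.1 hx).2.tail hxy⟩
  have hcK : c ∈ K := hstep hbK ⟨hbc, hc, hac, hcd⟩
  have hS : ∀ {x}, x ∈ K → G.Adj a x ∧ ¬ G.Adj x d := by
    intro x hx
    rcases (Finset.mem_filter.1 hx).2.cases_tail with h | ⟨y, _, h⟩
    · exact h ▸ ⟨hab, hbd⟩
    · exact h.2.2
  have hedge : ∀ {x y z}, x ∈ K → y ∈ K → G.Adj x y → z ∈ M → z ∉ K → G.Adj x z → G.Adj y z := by
    intro x y z hx hy hxy hz hzK hxz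
    by_contra hyz
    obtain ⟨hax, hxd⟩ := hS hx
    obtain ⟨hay, hyd⟩ := hS hy
    by_cases haz : G.Adj a z
    · by_cases hzd : G.Adj z d
      · exact hP (isIndContained_P5sq hay hax haz had hxy.symm hxz hzd hyz hyd hxd)
      · exact hzK (hstep hx ⟨hxz, hz, haz, hzd⟩)
    · by_cases hdz : G.Adj d z
      · exact hC (isIndContained_C5plus hax hay hxy had hxz hxd hyd haz hyz hdz)
      · exact hB (isIndContained_bull hax hay hxy had hxz hxd hyd haz hyz hdz)
  have hmodb : ∀ {x z}, x ∈ K → z ∈ M → z ∉ K → (G.Adj b z ↔ G.Adj x z) := by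
    intro x z hx hz hzK
    have hpath := (Finset.mem_filter.1 hx).2
    clear hx
    have : x ∈ K ∧ (G.Adj b z ↔ G.Adj x z) := by
      induction hpath with
      | refl => exact ⟨hbK, Iff.rfl⟩
      | tail _ h ih =>
        have hy := hstep ih.1 h
        exact ⟨hy, ih.2.trans ⟨hedge ih.1 hy h.1 hz hzK, hedge hy ih.1 h.1.symm hz hzK⟩⟩
    exact this.2
  have hlift : ∀ {x y}, x ∈ K → y ∈ K → TwinsIn G K x y → TwinsIn G M x y := by
    intro x y hx hy h z hz hzx hzy
    by_cases hzK : z ∈ K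
    · exact h z hzK hzx hzy
    · exact (hmodb hx hz hzK).symm.trans (hmodb hy hz hzK)
  have haK : a ∉ K := fun h => G.loopless.irrefl _ (hS h).1
  have hssub : K ⊂ M := Finset.ssubset_iff_subset_ne.2
    ⟨Finset.filter_subset _ _, fun h => haK (h ▸ ha)⟩
  have hnone : ∀ x ∈ K, ∀ y ∈ K, x ≠ y → ¬ TwinsIn G K x y := fun x hx y hy hxy h =>
    hM x (hKM hx) y (hKM hy) hxy (hlift hx hy h)
  have htri : ∀ p ∈ K, ∀ q ∈ K, ∀ r ∈ K, G.Adj p q → G.Adj p r → ¬ G.Adj q r := by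
    intro p hp q hq r hr hpq hpr hqr
    obtain ⟨x, hx, y, hy, hxy, h⟩ := ih K hssub hp hq hr hpq hpr hqr
    exact hnone x hx y hy hxy h
  have hP4 : ∀ p ∈ K, ∀ q ∈ K, ∀ r ∈ K, ∀ t ∈ K, G.Adj p q → G.Adj q r → G.Adj r t →
      G.Adj p r ∨ G.Adj p t ∨ G.Adj q t := by
    intro p hp q hq r hr t ht hpq hqr hrt
    by_contra! h
    exact hP (isIndContained_P5sq (hS hp).1 (hS hq).1 (hS hr).1 (hS ht).1 hpq hqr hrt h.1 h.2.1
      h.2.2)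
  have huniq : ∀ p ∈ K, ∀ x ∈ K, ∀ y ∈ K, G.Adj p x → G.Adj p y → x = y := by
    intro p hp x hx y hy hpx hpy
    by_contra hxy
    exact hnone x hx y hy hxy (twinsIn_of_common_neighbor hp hx hy hpx hpy htri hP4)
  -- Every vertex of `K` has only one neighbour in `K`, so `K = {b, c}`.
  have hKbc : ∀ x, Relation.ReflTransGen R b x → x = b ∨ x = c := by
    intro x hx
    induction hx with
    | refl => exact Or.inl rfl
    | tail _ h ih =>
      rcases ih with rfl | rfl
      · exact Or.inr (huniq _ hbK _ (hstep hbK h) _ hcK h.1 hbc)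
      · exact Or.inl (huniq _ hcK _ (hstep hcK h) _ hbK h.1 hbc.symm)
  refine hnone b hbK c hcK hbc.ne fun z hz hzb hzc => ?_
  rcases hKbc z (Finset.mem_filter.1 hz).2 with h | h
  · exact absurd h hzb
  · exact absurd h hzc

/-! ### Odd holes -/

/-- A shortest odd closed walk in a triangle-free graph runs along an induced cycle: a repeated
vertex or a chord would split it into two closed walks, one of which is odd and shorter. -/
theorem exists_odd_hole (htri : ∀ a b c, G.Adj a b → G.Adj a c → ¬ G.Adj b c)
    (hbip : ¬ G.IsBipartite) : ∃ n, 5 ≤ n ∧ Odd n ∧ (cycleGraph n).IsIndContained G := by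
  classical
  have hex : ∃ n, Odd n ∧ ∃ (v : V) (p : G.Walk v v), p.length = n := by
    by_contra! h
    exact hbip (two_colorable_iff_forall_loop_even.2 fun v p => by
      by_contra hp
      exact h _ (Nat.not_even_iff_odd.1 hp) v p rfl)
  obtain ⟨hodd, u, p, hp⟩ := Nat.find_spec hex
  have hmin : ∀ (v : V) (q : G.Walk v v), Odd q.length → Nat.find hex ≤ q.length :=
    fun v q hq => Nat.find_min' hex ⟨hq, v, q, rfl⟩
  generalize Nat.find hex = n at hodd hp hmin
  let f : ℕ → V := p.getVert
  have hf : ∀ i, i < n → G.Adj (f i) (f (i + 1)) := fun i hi => p.adj_getVert_succ (by omega)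
  have hf0 : f 0 = u := p.getVert_zero
  have hfn : f n = u := by
    rw [← hp]
    exact p.getVert_length
  have hseg : ∀ i j, i ≤ j → j ≤ n → ∃ q : G.Walk (f i) (f j), q.length = j - i := by
    intro i j hij
    induction j, hij using Nat.le_induction with
    | base => exact fun _ => ⟨.nil, by simp⟩
    | succ j hij ih =>
      intro hj
      obtain ⟨q, hq⟩ := ih (by omega)
      exact ⟨q.concat (hf j (by omega)), by rw [Walk.length_concat]; omega⟩
  have hco : ∀ i j, i < j → j < n → ∃ q : G.Walk (f j) (f i), q.length = n - (j - i) := by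
    intro i j hij hj
    obtain ⟨q1, h1⟩ := hseg j n hj.le le_rfl
    obtain ⟨q2, h2⟩ := hseg 0 i (Nat.zero_le i) (by omega)
    refine ⟨(q1.copy rfl (hfn.trans hf0.symm)).append q2, ?_⟩
    rw [Walk.length_append, Walk.length_copy]
    omega
  have hne : ∀ i j, i < j → j < n → f i ≠ f j := by
    intro i j hij hj h
    obtain ⟨q1, h1⟩ := hseg i j hij.le hj.le
    obtain ⟨q2, h2⟩ := hco i j hij hj
    have m1 := hmin _ (q1.copy rfl h.symm)
    have m2 := hmin _ (q2.copy rfl h)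
    rw [Walk.length_copy] at m1 m2
    rcases Nat.even_or_odd (j - i) with he | ho
    · have := m2 (by rw [h2, Nat.odd_sub (by omega)]; simp [hodd, he])
      omega
    · have := m1 (h1 ▸ ho)
      omega
  have hchord : ∀ i j, i < j → j < n → G.Adj (f i) (f j) → i + 1 = j ∨ (i = 0 ∧ j + 1 = n) := by
    intro i j hij hj h
    obtain ⟨q1, h1⟩ := hseg i j hij.le hj.le
    obtain ⟨q2, h2⟩ := hco i j hij hj
    have m1 := hmin _ (q1.concat h.symm)
    have m2 := hmin _ (q2.concat h)
    rw [Walk.length_concat] at m1 m2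
    rcases Nat.even_or_odd (j - i) with he | ho
    · have := m1 (h1 ▸ he.add_one)
      omega
    · have : Even (n - (j - i)) := Nat.Odd.sub_odd hodd ho
      have := m2 (h2 ▸ this.add_one)
      omega
  have hn1 : n ≠ 1 := by
    rintro rfl
    have := hf 0 (by omega)
    rw [hf0, hfn] at this
    exact G.loopless.irrefl _ this
  have hn3 : n ≠ 3 := by
    rintro rfl
    have h01 := hf 0 (by omega)
    have h12 := hf 1 (by omega)
    have h20 := hf 2 (by omega)
    rw [hfn, ← hf0] at h20
    exact htri _ _ _ h01 h20.symm h12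
  obtain ⟨k, hk⟩ := hodd
  have hn5 : 5 ≤ n := by omega
  have hwrap : G.Adj (f (n - 1)) (f 0) := by
    have := hf (n - 1) (by omega)
    rwa [Nat.sub_add_cancel (by omega), hfn, ← hf0] at this
  refine ⟨n, hn5, ⟨k, hk⟩, ⟨⟨⟨fun i => f i, ?_⟩, ?_⟩⟩⟩
  · intro i j hij
    rcases lt_trichotomy i j with h | h | h
    · exact absurd hij (hne i j h j.isLt)
    · exact h
    · exact absurd hij.symm (hne j i h i.isLt)
  · intro i j
    change G.Adj (f i) (f j) ↔ _
    have hi := i.isLt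
    have hj := j.isLt
    rw [cycleGraph_adj_iff (by omega)]
    constructor
    · intro h
      rcases lt_trichotomy (i : ℕ) j with hij | hij | hij
      · have := hchord i j hij hj h
        omega
      · exact absurd (congrArg f hij) h.ne
      · have := hchord j i hij hi h.symm
        omega
    · rintro (h | h | ⟨h, h'⟩ | ⟨h, h'⟩)
      · rw [← h]
        exact hf i hi
      · rw [← h]
        exact (hf j hj).symm
      · rw [h, show (j : ℕ) = n - 1 by omega]
        exact hwrap.symm
      · rw [h, show (i : ℕ) = n - 1 by omega]
        exact hwrap

/-! ### The equivalence -/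

/-- Absence of the forbidden induced subgraphs passes to induced subgraphs, so twins can be removed
one at a time until the graph is triangle-free, and then it is bipartite. -/
theorem exists_bipartite_obtainableByCloning {V : Type u} [Finite V] (G : SimpleGraph V)
    (hO : ∀ n : ℕ, 5 ≤ n → Odd n → ¬ (cycleGraph n).IsIndContained G)
    (hC : ¬ C5plus.IsIndContained G) (hP : ¬ P5sq.IsIndContained G)
    (hB : ¬ bull.IsIndContained G) :
    ∃ (U : Type u) (H : SimpleGraph U), Finite U ∧ H.IsBipartite ∧ ObtainableByCloning H G := by
  classical
  induction hn : Nat.card V using Nat.strong_induction_on generalizing V with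
  | _ n ih =>
  have := Fintype.ofFinite V
  by_cases htri : ∀ a b c, G.Adj a b → G.Adj a c → ¬ G.Adj b c
  · refine ⟨V, G, inferInstance, ?_, .start G ⟨Iso.refl⟩⟩
    by_contra hbip
    obtain ⟨n, hn, hodd, h⟩ := exists_odd_hole htri hbip
    exact hO n hn hodd h
  · push Not at htri
    obtain ⟨a, b, c, hab, hac, hbc⟩ := htri
    obtain ⟨x, -, x', -, hne, htw⟩ := exists_twinsIn_of_triangle hC hP hB Finset.univ
      (Finset.mem_univ a) (Finset.mem_univ b) (Finset.mem_univ c) hab hac hbc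
    have hind : (G.induce ({x'}ᶜ : Set V)).IsIndContained G := ⟨Embedding.induce _⟩
    have hcard : Nat.card ({x'}ᶜ : Set V) < n := by
      rw [← hn]
      exact Finite.card_subtype_lt (x := x') (by simp)
    obtain ⟨U, H, hU, hH, hob⟩ := ih _ hcard (G.induce ({x'}ᶜ : Set V))
      (fun m hm hodd h => hO m hm hodd (h.trans hind)) (fun h => hC (h.trans hind))
      (fun h => hP (h.trans hind)) (fun h => hB (h.trans hind)) rfl
    exact ⟨U, H, hU, hH, .clone _ G hob
      ⟨x, x', hne, fun z => htw z (Finset.mem_univ z), ⟨Iso.refl⟩⟩⟩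

end TokenGame

theorem theorem2p4 {V : Type u} [Finite V] [Nonempty V] (G : SimpleGraph V) :
    List.TFAE [
      TokenGame.OnlinePerfect G,
      TokenGame.value 2 G = 2,
      (∀ n : ℕ, 5 ≤ n → Odd n → ¬ (SimpleGraph.cycleGraph n).IsIndContained G) ∧
        ¬ TokenGame.C5plus.IsIndContained G ∧
        ¬ TokenGame.P5sq.IsIndContained G ∧
        ¬ TokenGame.bull.IsIndContained G,
      ∃ (U : Type u) (H : SimpleGraph U), Finite U ∧ H.IsBipartite ∧
        TokenGame.ObtainableByCloning H G] := by
  open TokenGame in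
  tfae_have 1 → 2 := fun h => h 2
  tfae_have 2 → 3 := fun h =>
    ⟨fun n hn hodd => not_isIndContained_of_value_le h.le (not_value_cycleGraph_le hn hodd),
      not_isIndContained_of_value_le h.le not_value_C5plus_le,
      not_isIndContained_of_value_le h.le not_value_P5sq_le,
      not_isIndContained_of_value_le h.le not_value_bull_le⟩
  tfae_have 3 → 4 := fun ⟨hO, hC, hP, hB⟩ => exists_bipartite_obtainableByCloning G hO hC hP hB
  tfae_have 4 → 1 := fun ⟨_, _, _, hH, h⟩ w => le_antisymm (h.value_le hH) (le_value G w)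
  tfae_finish
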